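/- Let $D\subseteq\mathbb R^3$ be open and let $u\in C^3(D)$ be real-valued with $\nabla u\in L^2(D)$; fields on $D$ are regarded as zero outside $D$. For a ray $s\mapsto x+s\xi$, $|\xi|=1$, put $L=\{s: x+s\xi\in D\}$. The histogram longitudinal ray transform (HLRT) of a vector field $f$ is the distribution (push-forward of Lebesgue measure on $L$) of $s\mapsto \xi\cdot f(x+s\xi)$; its second moment is the integral of $y^2$ against this measure. The longitudinal ray transform (LRT) of a rank-2 tensor field $F$ is $\int_L \xi\cdot F(x+s\xi)\cdot\xi\,ds$. (Integrals that do not exist are given the value $0$.) The Kröner tensor of $F$ is $K_{mn}=\epsilon_{mki}\epsilon_{nj\ell}F_{ij,k\ell}$ (summation convention). Let $f=\mathrm du=\nabla u$, let $K=K_u$ be the Kröner tensor of $\mathrm du\odot\mathrm du$, and let $\mathrm d^2u=(u_{,ij})$. Then: 1. For every ray, the second moment of the HLRT of $\mathrm du$ equals the LRT of $\mathrm du\odot \mathrm du$, and one of the two integrals exists if and only if the other does. 2. $K$ is determined on $D$ by the second moment: if $v\in C^3(D)$, $\nabla v\in L^2(D)$, and the HLRTs of $\mathrm dv$ and $\mathrm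 du$ have the same second moment on every ray, then $K_v=K_u$ on $D$. 3. $K=2\,\mathrm{Adj}(\mathrm d^2u)$ on $D$. 4. At every $x\in D$ with $\det K\neq0$ one has $\det K>0$ and $\mathrm d^2u=\pm\sqrt{\tfrac12\det K}\;K^{-1}$. 5. Let $\Omega\subseteq D$ be bounded, open and connected, with $\det K\ne0$ on $\Omega$ and $u$ continuous on $\overline\Omega$. For a sign $\tau\in\{1,-1\}$ and a function $g$, let $P(\tau,g)$ be the Dirichlet problem $$\nabla^2 w=\tau\sqrt{\tfrac12\det K}\;\mathrm{trace}\,K^{-1}\ \text{ in }\Omega,\qquad w=g\ \text{ on }\partial\Omega,\qquad w\in C^2(\Omega)\cap C(\overline\Omega).$$ Each $P(\tau,g)$ has at most one solution. There is a single sign $\sigma\in\{1,-1\}$ such that $\mathrm d^2u=\sigma\sqrt{\frac12\det K}\,K^{-1}$ throughout $\Omega$; $u$ is the solution of $P(\sigma,u)$, and, for each sign $\tau$, the unique solution on $\overline\Omega$ of $P(\tau\sigma,\tau u)$ is $\tau u$. If $u=0$ on $\partial\Omega$, the solutions of $P(1,0)$ and $P(-1,0)$ together are exactly $u$ and $-u$.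 Consequently, let $v\in C^3(D)\cap C(\overline\Omega)$ with $\nabla v\in L^2(D)$ have the same second moment data as $u$. Then for one sign $\tau$ we have $\mathrm d^2v=\tau\,\mathrm d^2u$ on $\Omega$, and if $v=\tau u$ on $\partial\Omega$ for this $\tau$, then $v=\tau u$ on $\overline\Omega$. If $v=u$ on $\partial\Omega$, then either $v=u$ on $\overline\Omega$ or $v$ is the solution of the Poisson problem with the opposite sign, $P(-\sigma,u)$. If $u=v=0$ on $\partial\Omega$, then $v=u$ or $v=-u$ on $\overline\Omega$. -/

import Mathlib

open MeasureTheory Set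

noncomputable section

/-- Euclidean three-space. -/
abbrev E3 : Type := EuclideanSpace ℝ (Fin 3)

/-- Rank-2 tensors on Euclidean three-space, by Cartesian components. -/
abbrev Tensor2 : Type := Matrix (Fin 3) (Fin 3) ℝ

/-- The chord of the ray `s ↦ x + s ξ` in `D`, as a set of parameters. -/
def chord (D : Set E3) (x ξ : E3) : Set ℝ := {s | x + s • ξ ∈ D}

/-- The histogram longitudinal ray transform of the vector field `f` on `D`: for each ray, the
distribution (push-forward of length) of `s ↦ ξ · f(x + s ξ)` over the part of the ray in `D`. -/
def histogramLRT (D : Set E3) (f : E3 → E3) (x ξ : E3) : Measure ℝ :=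
  Measure.map (fun s : ℝ => inner ℝ ξ (f (x + s • ξ))) (volume.restrict (chord D x ξ))

/-- The `k`-th moment of a distribution on the real line. -/
def distributionMoment (k : ℕ) (μ : Measure ℝ) : ℝ := ∫ y, y ^ k ∂μ

/-- The second moment of the histogram longitudinal ray transform, as a function of the ray. -/
def secondMomentHLRT (D : Set E3) (f : E3 → E3) (x ξ : E3) : ℝ :=
  distributionMoment 2 (histogramLRT D f x ξ)

/-- The contraction `ξ · A · ξ`. -/
def contract (A : Tensor2) (ξ : E3) : ℝ := ∑ i, ∑ j, ξ i * A i j * ξ j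

/-- The longitudinal ray transform of the rank-2 tensor field `F` on `D` (taken as zero
outside `D`). -/
def tensorLRT (D : Set E3) (F : E3 → Tensor2) (x ξ : E3) : ℝ :=
  ∫ s in chord D x ξ, contract (F (x + s • ξ)) ξ

/-- The symmetric tensor product of two vectors. -/
def symProd (a b : E3) : Tensor2 := Matrix.of fun i j => (a i * b j + a j * b i) / 2

/-- The rank-2 tensor field `du ⊙ du`. -/
def gradSq (u : E3 → ℝ) (x : E3) : Tensor2 := symProd (gradient u x) (gradient u x)

/-- The partial derivative in the `i`-th Cartesian coordinate. -/
def partialDeriv (i : Fin 3) (g : E3 → ℝ) (x : E3) : ℝ :=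
  fderiv ℝ g x (EuclideanSpace.single i 1)

/-- The second derivative matrix `d²u`, with entries `u_{,ij}`. -/
def hessianMatrix (u : E3 → ℝ) (x : E3) : Tensor2 :=
  Matrix.of fun i j => partialDeriv j (partialDeriv i u) x

/-- The permutation symbol `ε_{ijk}`, for `i, j, k` in `{0, 1, 2}`. -/
def permSymbol (i j k : Fin 3) : ℝ :=
  (((j : ℕ) : ℝ) - ((i : ℕ) : ℝ)) * (((k : ℕ) : ℝ) - ((i : ℕ) : ℝ)) *
    (((k : ℕ) : ℝ) - ((j : ℕ) : ℝ)) / 2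

/-- The Kröner tensor of a rank-2 tensor field,
`K_{mn} = ε_{mki} ε_{njl} F_{ij,kl}` (sum over `i, j, k, l`). -/
def kronerTensor (F : E3 → Tensor2) (x : E3) : Tensor2 :=
  Matrix.of fun m n => ∑ k, ∑ i, ∑ j, ∑ l,
    permSymbol m k i * permSymbol n j l *
      partialDeriv l (partialDeriv k (fun y => F y i j)) x

/-- `u` is a potential of class `C³` on `D` whose gradient is square integrable on `D`. -/
structure IsDopplerPotential (D : Set E3) (u : E3 → ℝ) : Prop where
  contDiffOn : ContDiffOn ℝ 3 u D
  memLp : MemLp (gradient u) 2 (volume.restrict D)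

/-- The function `√(½ det K) · trace K⁻¹`. -/
def poissonSource (K : E3 → Tensor2) (x : E3) : ℝ :=
  Real.sqrt ((1 / 2) * (K x).det) * ((K x)⁻¹).trace

/-- `w` is a classical solution of the Dirichlet problem `Δw = h` in `Ω`, `w = g` on `∂Ω`. -/
structure IsDirichletSolution (Ω : Set E3) (h g w : E3 → ℝ) : Prop where
  contDiffOn : ContDiffOn ℝ 2 w Ω
  continuousOn : ContinuousOn w (closure Ω)
  laplacian_eq : ∀ x ∈ Ω, Laplacian.laplacian w x = h x
  boundary_eq : ∀ x ∈ frontier Ω, w x = g x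

end

/-! Integration against a push-forward turns the second moment into the integral of (ξ·∇u)² along
the chord, which is the LRT of du⊙du. The rest rests on two facts about the Kröner tensor.

It is determined by the ray transform. Let G be the difference of two such fields, extended by zero;
it is integrable because the gradients are in L². By projection-slice
(`fourier_eq_zero_of_ae_integral_ray_eq_zero`), ξ·Ĝ(k)·ξ = 0 for ξ ⟂ k, and polarization extends
this to all pairs of vectors orthogonal to k. The Kröner symbol contracts Ĝ(k) with exactly such
vectors, so K_G = 0 as a distribution (`sum_integral_kroner_eq_zero`). Inside D, where G is C²,
integration by parts and continuity make this a pointwise identity (`kronerTensor_eq_zero`).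

It is algebraic in the Hessian H. The third derivatives cancel against the antisymmetric permutation
symbols, leaving K = 2 Adj H (`kronerTensor_gradSq`). In dimension three det K = 8 (det H)², so K
gives back H up to the sign of det H, and this sign is constant on a connected set where det H ≠ 0
(`exists_sign_hessianMatrix_eq`). The trace of the formula for H is a Poisson equation for u, whose
Dirichlet problem has at most one solution by the maximum principle (`IsDirichletSolution.eqOn`).
All that is left unknown is one global sign. -/

/-! ### Calculus of coordinate derivatives -/

theorem gradient_apply_eq_partialDeriv (u : E3 → ℝ) (x : E3) (i : Fin 3) :
    gradient u x i = partialDeriv i u x := by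
  have h := EuclideanSpace.inner_single_left (𝕜 := ℝ) i (1 : ℝ) (gradient u x)
  rw [partialDeriv]
  simp only [map_one, one_mul] at h
  rw [← h, real_inner_comm, gradient, InnerProductSpace.toDual_symm_apply]

theorem contDiffOn_partialDeriv {D : Set E3} (hD : IsOpen D) {g : E3 → ℝ} {m n : WithTop ℕ∞}
    (hg : ContDiffOn ℝ n g D) (hmn : m + 1 ≤ n) (i : Fin 3) :
    ContDiffOn ℝ m (partialDeriv i g) D :=
  (hg.fderiv_of_isOpen hD hmn).clm_apply contDiffOn_const

theorem partialDeriv_congr {D : Set E3} (hD : IsOpen D) {f g : E3 → ℝ} (h : EqOn f g D)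
    (i : Fin 3) : EqOn (partialDeriv i f) (partialDeriv i g) D := fun x hx => by
  have : f =ᶠ[nhds x] g := h.eventuallyEq_of_mem (hD.mem_nhds hx)
  rw [partialDeriv, partialDeriv, this.fderiv_eq]

theorem partialDeriv_mul {f g : E3 → ℝ} {x : E3} (hf : DifferentiableAt ℝ f x)
    (hg : DifferentiableAt ℝ g x) (i : Fin 3) :
    partialDeriv i (fun y => f y * g y) x =
      partialDeriv i f x * g x + f x * partialDeriv i g x := by
  simp only [partialDeriv]
  rw [fderiv_fun_mul hf hg]
  simp; ring

theorem partialDeriv_add {f g : E3 → ℝ} {x : E3} (hf : DifferentiableAt ℝ f x)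
    (hg : DifferentiableAt ℝ g x) (i : Fin 3) :
    partialDeriv i (fun y => f y + g y) x = partialDeriv i f x + partialDeriv i g x := by
  simp only [partialDeriv]
  rw [fderiv_fun_add hf hg]
  simp

theorem partialDeriv_sub {f g : E3 → ℝ} {x : E3} (hf : DifferentiableAt ℝ f x)
    (hg : DifferentiableAt ℝ g x) (i : Fin 3) :
    partialDeriv i (fun y => f y - g y) x = partialDeriv i f x - partialDeriv i g x := by
  simp only [partialDeriv]
  rw [fderiv_fun_sub hf hg]
  simp

theorem partialDeriv_partialDeriv_eq_fderiv_fderiv {g : E3 → ℝ} {x : E3}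
    (hg : ContDiffAt ℝ 2 g x) (i j : Fin 3) :
    partialDeriv j (partialDeriv i g) x =
      fderiv ℝ (fderiv ℝ g) x (EuclideanSpace.single j 1) (EuclideanSpace.single i 1) := by
  have h : DifferentiableAt ℝ (fderiv ℝ g) x :=
    (hg.fderiv_right (m := 1) le_rfl).differentiableAt one_ne_zero
  have e : partialDeriv i g = fun y => fderiv ℝ g y (EuclideanSpace.single i 1) := rfl
  rw [partialDeriv, e, fderiv_clm_apply h (differentiableAt_const _)]
  simp

theorem partialDeriv_comm {g : E3 → ℝ} {x : E3} (hg : ContDiffAt ℝ 2 g x) (i j : Fin 3) :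
    partialDeriv j (partialDeriv i g) x = partialDeriv i (partialDeriv j g) x := by
  rw [partialDeriv_partialDeriv_eq_fderiv_fderiv hg, partialDeriv_partialDeriv_eq_fderiv_fderiv hg]
  exact (hg.isSymmSndFDerivAt (by simp)).eq _ _

theorem laplacian_eq_trace_hessianMatrix {g : E3 → ℝ} {x : E3} (hg : ContDiffAt ℝ 2 g x) :
    Laplacian.laplacian g x = (hessianMatrix g x).trace := by
  rw [congrFun (InnerProductSpace.laplacian_eq_iteratedFDeriv_orthonormalBasis g
    (EuclideanSpace.basisFun (Fin 3) ℝ)) x, Matrix.trace]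
  refine Finset.sum_congr rfl fun i _ => ?_
  rw [Matrix.diag, hessianMatrix, Matrix.of_apply,
    partialDeriv_partialDeriv_eq_fderiv_fderiv hg, iteratedFDeriv_two_apply]
  simp

/-- `(a b)_{,kl}` for the product of two functions of class `C²`. -/
theorem partialDeriv_partialDeriv_mul {D : Set E3} (hD : IsOpen D) {a b : E3 → ℝ}
    (ha : ContDiffOn ℝ 2 a D) (hb : ContDiffOn ℝ 2 b D) {x : E3} (hx : x ∈ D) (k l : Fin 3) :
    partialDeriv l (partialDeriv k (fun y => a y * b y)) x =
      partialDeriv l (partialDeriv k a) x * b x + partialDeriv k a x * partialDeriv l b x +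
      (partialDeriv l a x * partialDeriv k b x + a x * partialDeriv l (partialDeriv k b) x) := by
  have hda : ∀ y ∈ D, DifferentiableAt ℝ a y := fun y hy =>
    (ha.contDiffAt (hD.mem_nhds hy)).differentiableAt two_ne_zero
  have hdb : ∀ y ∈ D, DifferentiableAt ℝ b y := fun y hy =>
    (hb.contDiffAt (hD.mem_nhds hy)).differentiableAt two_ne_zero
  have hda' : DifferentiableAt ℝ (partialDeriv k a) x :=
    ((contDiffOn_partialDeriv (m := 1) hD ha le_rfl k).contDiffAt
      (hD.mem_nhds hx)).differentiableAt one_ne_zero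
  have hdb' : DifferentiableAt ℝ (partialDeriv k b) x :=
    ((contDiffOn_partialDeriv (m := 1) hD hb le_rfl k).contDiffAt
      (hD.mem_nhds hx)).differentiableAt one_ne_zero
  rw [partialDeriv_congr hD (fun y hy => partialDeriv_mul (hda y hy) (hdb y hy) k) l hx,
    partialDeriv_add (hda'.fun_mul (hdb x hx)) ((hda x hx).fun_mul hdb'),
    partialDeriv_mul hda' (hdb x hx), partialDeriv_mul (hda x hx) hdb']

/-! ### The Kröner tensor of du ⊙ du -/

theorem gradSq_apply (u : E3 → ℝ) (x : E3) (i j : Fin 3) :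
    gradSq u x i j = partialDeriv i u x * partialDeriv j u x := by
  simp only [gradSq, symProd, Matrix.of_apply, gradient_apply_eq_partialDeriv]
  ring

theorem hessianMatrix_isSymm {u : E3 → ℝ} {x : E3} (hu : ContDiffAt ℝ 2 u x) (i j : Fin 3) :
    hessianMatrix u x i j = hessianMatrix u x j i := by
  simp only [hessianMatrix, Matrix.of_apply]
  exact partialDeriv_comm hu i j

/-- The Kröner tensor of `du ⊙ du` is twice the adjugate of the Hessian. -/
theorem kronerTensor_gradSq {D : Set E3} (hD : IsOpen D) {u : E3 → ℝ} (hu : ContDiffOn ℝ 3 u D)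
    {x : E3} (hx : x ∈ D) :
    kronerTensor (gradSq u) x = (2 : ℝ) • (hessianMatrix u x).adjugate := by
  have hu2 : ∀ y ∈ D, ContDiffAt ℝ 2 u y := fun y hy =>
    (hu.contDiffAt (hD.mem_nhds hy)).of_le (by norm_num)
  have hd : ∀ i, ContDiffOn ℝ 2 (partialDeriv i u) D := fun i =>
    contDiffOn_partialDeriv hD hu (by norm_num) i
  have hd' : ∀ i, ContDiffAt ℝ 2 (partialDeriv i u) x := fun i =>
    (hd i).contDiffAt (hD.mem_nhds hx)
  set H := hessianMatrix u x with hH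
  -- By `T1` and `T2` the third derivatives are totally symmetric, so they vanish against ε_{mki} or
  -- ε_{njl}; so does H_{ik}H_{jl}. Only H_{il}H_{jk} survives, giving twice the cofactor.
  set T : Fin 3 → Fin 3 → Fin 3 → ℝ := fun i k l =>
    partialDeriv l (partialDeriv k (partialDeriv i u)) x with hT
  have T1 : ∀ i k l, T i k l = T k i l := fun i k l =>
    partialDeriv_congr hD (fun y hy => partialDeriv_comm (hu2 y hy) i k) l hx
  have T2 : ∀ i k l, T i k l = T i l k := fun i k l => partialDeriv_comm (hd' i) k l
  have HS : ∀ i j, H i j = H j i := hessianMatrix_isSymm (hu2 x hx)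
  have key : ∀ i j k l, partialDeriv l (partialDeriv k (fun y => gradSq u y i j)) x =
      T i k l * partialDeriv j u x + H i k * H j l +
        (H i l * H j k + partialDeriv i u x * T j k l) := by
    intro i j k l
    simp only [gradSq_apply]
    exact partialDeriv_partialDeriv_mul hD (hd i) (hd j) hx k l
  ext m n
  simp only [kronerTensor, Matrix.of_apply, key, Matrix.smul_apply, smul_eq_mul]
  clear_value H T
  -- Only instances with decreasing indices are kept: as rewrite rules they sort the indices and
  -- cannot loop.
  have a1 := HS 1 0
  have a2 := HS 2 0
  have a3 := HS 2 1
  have b := fun l => T1 1 0 l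
  have c := fun l => T1 2 0 l
  have d := fun l => T1 2 1 l
  have b' := fun l => T2 l 1 0
  have c' := fun l => T2 l 2 0
  have d' := fun l => T2 l 2 1
  fin_cases m <;> fin_cases n <;>
    simp [Matrix.adjugate_fin_three, Fin.sum_univ_three, permSymbol] <;>
    norm_num <;> simp only [a1, a2, a3, b, c, d, b', c', d'] <;> ring

/-! ### The second moment as a ray transform -/

theorem isOpen_chord {D : Set E3} (hD : IsOpen D) (x ξ : E3) : IsOpen (chord D x ξ) :=
  hD.preimage (by fun_prop)

theorem contract_gradSq (u : E3 → ℝ) (x ξ : E3) :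
    contract (gradSq u x) ξ = inner ℝ ξ (gradient u x) ^ 2 := by
  simp only [contract, gradSq_apply, PiLp.inner_apply, gradient_apply_eq_partialDeriv]
  simp [Fin.sum_univ_three]
  ring

theorem continuousOn_gradient {D : Set E3} (hD : IsOpen D) {u : E3 → ℝ}
    (hu : ContDiffOn ℝ 1 u D) : ContinuousOn (gradient u) D :=
  (InnerProductSpace.toDual ℝ E3).symm.continuous.comp_continuousOn
    (hu.continuousOn_fderiv_of_isOpen hD le_rfl)

theorem aemeasurable_inner_gradient {D : Set E3} (hD : IsOpen D) {u : E3 → ℝ}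
    (hu : ContDiffOn ℝ 1 u D) (x ξ : E3) :
    AEMeasurable (fun s : ℝ => inner ℝ ξ (gradient u (x + s • ξ)))
      (volume.restrict (chord D x ξ)) := by
  refine ContinuousOn.aemeasurable ?_ (isOpen_chord hD x ξ).measurableSet
  refine continuousOn_const.inner ((continuousOn_gradient hD hu).comp (by fun_prop) ?_)
  exact fun s hs => hs

theorem secondMomentHLRT_gradient {D : Set E3} (hD : IsOpen D) {u : E3 → ℝ}
    (hu : ContDiffOn ℝ 1 u D) (x ξ : E3) :
    secondMomentHLRT D (gradient u) x ξ = tensorLRT D (gradSq u) x ξ := by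
  rw [secondMomentHLRT, distributionMoment, histogramLRT,
    integral_map (aemeasurable_inner_gradient hD hu x ξ) (by fun_prop), tensorLRT]
  simp only [contract_gradSq]

theorem integrable_sq_histogramLRT_iff {D : Set E3} (hD : IsOpen D) {u : E3 → ℝ}
    (hu : ContDiffOn ℝ 1 u D) (x ξ : E3) :
    Integrable (fun y : ℝ => y ^ 2) (histogramLRT D (gradient u) x ξ) ↔
      IntegrableOn (fun s : ℝ => contract (gradSq u (x + s • ξ)) ξ) (chord D x ξ) := by
  rw [histogramLRT, integrable_map_measure (by fun_prop) (aemeasurable_inner_gradient hD hu x ξ)]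
  simp only [contract_gradSq]
  rfl

/-! ### Recovering a matrix from its adjugate -/

theorem det_two_smul_adjugate (H : Tensor2) : ((2 : ℝ) • H.adjugate).det = 8 * H.det ^ 2 := by
  rw [Matrix.det_smul, Matrix.det_adjugate]
  simp; norm_num

/-- The root is 2|det H|, and Adj H · H = (det H) I makes the inverse H / (2 det H). The remaining
factor is the sign of det H. -/
theorem sqrt_smul_inv_two_smul_adjugate {H : Tensor2} (hH : H.det ≠ 0) :
    Real.sqrt ((1 / 2) * ((2 : ℝ) • H.adjugate).det) • ((2 : ℝ) • H.adjugate)⁻¹ =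
      (|H.det| / H.det) • H := by
  have h1 : Real.sqrt ((1 / 2) * ((2 : ℝ) • H.adjugate).det) = 2 * |H.det| := by
    rw [det_two_smul_adjugate, show (1 / 2) * (8 * H.det ^ 2) = (2 * |H.det|) ^ 2 by
      rw [mul_pow, sq_abs]; ring]
    exact Real.sqrt_sq (by positivity)
  have h2 : ((2 : ℝ) • H.adjugate)⁻¹ = (1 / (2 * H.det)) • H := by
    refine Matrix.inv_eq_right_inv ?_
    rw [Matrix.smul_mul, Matrix.mul_smul, Matrix.adjugate_mul, smul_smul, smul_smul]
    rw [show 2 * (1 / (2 * H.det)) * H.det = 1 by field_simp, one_smul]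
  rw [h1, h2, smul_smul]
  congr 1
  field_simp

/-! ### The maximum principle and uniqueness -/

/-- At an interior local maximum the Laplacian is nonpositive. -/
theorem laplacian_nonpos_of_isLocalMax {w : E3 → ℝ} {x : E3} (hw : ContDiffAt ℝ 2 w x)
    (hmax : IsLocalMax w x) : Laplacian.laplacian w x ≤ 0 := by
  rw [laplacian_eq_trace_hessianMatrix hw]
  refine Finset.sum_nonpos fun i _ => ?_
  rw [Matrix.diag, hessianMatrix, Matrix.of_apply]
  -- A positive second derivative along e would make 0 also a local minimum of the restriction `g`
  -- to that line. Then `g` is constant near 0, and its second derivative there is zero.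
  by_contra! hpos
  set e : E3 := EuclideanSpace.single i 1
  set g : ℝ → ℝ := fun t => w (x + t • e) with hg
  have hline : ∀ t : ℝ, HasDerivAt (fun t : ℝ => x + t • e) e t := fun t => by
    simpa using ((hasDerivAt_id t).smul_const e).const_add x
  have hcont : Filter.Tendsto (fun t : ℝ => x + t • e) (nhds 0) (nhds x) := by
    have : Continuous (fun t : ℝ => x + t • e) := by fun_prop
    simpa using this.tendsto 0
  have hev : ∀ᶠ y in nhds x, DifferentiableAt ℝ w y :=
    (hw.eventually (by simp)).mono fun y hy => hy.differentiableAt two_ne_zero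
  have hd1 : ∀ᶠ t in nhds (0 : ℝ), deriv g t = partialDeriv i w (x + t • e) :=
    (hcont.eventually hev).mono fun t ht =>
      (ht.hasFDerivAt.comp_hasDerivAt t (hline t)).deriv
  have hd2 : deriv (deriv g) 0 = partialDeriv i (partialDeriv i w) x := by
    rw [Filter.EventuallyEq.deriv_eq hd1]
    have hp : DifferentiableAt ℝ (partialDeriv i w) (x + (0 : ℝ) • e) := by
      rw [zero_smul, add_zero]
      exact ((hw.fderiv_right (m := 1) le_rfl).clm_apply contDiffAt_const).differentiableAt
        one_ne_zero
    have := (hp.hasFDerivAt.comp_hasDerivAt (0 : ℝ) (hline 0)).deriv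
    rw [zero_smul, add_zero] at this
    exact this
  have hgmax : IsLocalMax g 0 := by
    have := hcont.eventually hmax
    simpa [IsLocalMax, IsMaxFilter, hg] using this
  have hgc : ContinuousAt g 0 := by
    refine ContinuousAt.comp (g := w) ?_ (hline 0).continuousAt
    simpa using hw.continuousAt
  have hgmin := isLocalMin_of_deriv_deriv_pos (hd2 ▸ hpos) hgmax.deriv_eq_zero hgc
  have hconst : g =ᶠ[nhds 0] fun _ => g 0 := by
    filter_upwards [hgmax, hgmin] with t h1 h2 using le_antisymm h1 h2
  have h0 : deriv (deriv g) 0 = 0 := by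
    rw [Filter.EventuallyEq.deriv_eq hconst.deriv]
    simp
  linarith

/-- Supplies the strictly subharmonic perturbation used in the maximum principle. -/
theorem laplacian_norm_sq (x : E3) : Laplacian.laplacian (fun y : E3 => ‖y‖ ^ 2) x = 6 := by
  have e : (fun y : E3 => ‖y‖ ^ 2) = fun y => y 0 * y 0 + y 1 * y 1 + y 2 * y 2 := by
    ext y; simp [EuclideanSpace.norm_sq_eq, Fin.sum_univ_three]; ring
  have hc : ∀ i : Fin 3, ContDiff ℝ 2 fun y : E3 => y i := fun i => by fun_prop
  have hp : ∀ i j : Fin 3, partialDeriv j (fun y : E3 => y i) = fun _ => if i = j then 1 else 0 := by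
    intro i j; ext y
    have : (fun y : E3 => y i) = EuclideanSpace.proj (𝕜 := ℝ) i := rfl
    rw [partialDeriv, this, ContinuousLinearMap.fderiv]
    simp
  have hp2 : ∀ i : Fin 3, partialDeriv i (fun y : E3 => ‖y‖ ^ 2) = fun y => 2 * y i := by
    intro i; ext y
    have hd : ∀ j, DifferentiableAt ℝ (fun y : E3 => y j) y := fun j =>
      (hc j).differentiable two_ne_zero y
    rw [e, partialDeriv_add (((hd 0).fun_mul (hd 0)).fun_add ((hd 1).fun_mul (hd 1)))
      ((hd 2).fun_mul (hd 2)), partialDeriv_add ((hd 0).fun_mul (hd 0)) ((hd 1).fun_mul (hd 1))]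
    simp only [partialDeriv_mul (hd _) (hd _), hp]
    fin_cases i <;> simp <;> ring
  rw [laplacian_eq_trace_hessianMatrix (contDiff_norm_sq ℝ).contDiffAt]
  simp only [Matrix.trace, hessianMatrix, Matrix.diag, Matrix.of_apply, hp2]
  have hd : ∀ j, DifferentiableAt ℝ (fun y : E3 => y j) x := fun j =>
      (hc j).differentiable two_ne_zero x
  have h0 : ∀ i, partialDeriv i (fun _ : E3 => (2 : ℝ)) x = 0 := fun i => by simp [partialDeriv]
  simp only [partialDeriv_mul (differentiableAt_const (2 : ℝ)) (hd _), hp, h0]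
  simp; norm_num

/-- Weak maximum principle for subharmonic functions on a bounded open set. -/
theorem nonpos_of_laplacian_nonneg {Ω : Set E3} (hΩ : IsOpen Ω) (hb : Bornology.IsBounded Ω)
    {w : E3 → ℝ} (hw : ContDiffOn ℝ 2 w Ω) (hc : ContinuousOn w (closure Ω))
    (hl : ∀ x ∈ Ω, 0 ≤ Laplacian.laplacian w x) (h0 : ∀ x ∈ frontier Ω, w x ≤ 0) :
    ∀ x ∈ closure Ω, w x ≤ 0 := by
  obtain ⟨R, hR⟩ := hb.closure.exists_norm_le
  have hcomp : IsCompact (closure Ω) := hb.isCompact_closure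
  intro x hx
  -- Adding ε‖y‖² makes the Laplacian at least 6ε > 0, which excludes an interior maximum. The
  -- maximum over the closure is then on the frontier, where w ≤ 0.
  have hbound : ∀ ε : ℝ, 0 < ε → w x ≤ ε * R ^ 2 := by
    intro ε hε
    have hcε : ContinuousOn (w + ε • fun y : E3 => ‖y‖ ^ 2) (closure Ω) :=
      hc.add (by fun_prop)
    obtain ⟨z, hz, hzmax⟩ := hcomp.exists_isMaxOn ⟨x, hx⟩ hcε
    have hzx : w x + ε * ‖x‖ ^ 2 ≤ w z + ε * ‖z‖ ^ 2 := by simpa using hzmax hx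
    have hzf : z ∈ frontier Ω := by
      rw [hΩ.frontier_eq]
      refine ⟨hz, fun hzΩ => ?_⟩
      have hwz : ContDiffAt ℝ 2 w z := hw.contDiffAt (hΩ.mem_nhds hzΩ)
      have hn : ContDiffAt ℝ 2 (fun y : E3 => ‖y‖ ^ 2) z := (contDiff_norm_sq ℝ).contDiffAt
      have hn' : ContDiffAt ℝ 2 (ε • fun y : E3 => ‖y‖ ^ 2) z := hn.const_smul ε
      have hm : IsLocalMax (w + ε • fun y : E3 => ‖y‖ ^ 2) z :=
        hzmax.isLocalMax (Filter.mem_of_superset (hΩ.mem_nhds hzΩ) subset_closure)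
      have : Laplacian.laplacian (w + ε • fun y : E3 => ‖y‖ ^ 2) z ≤ 0 :=
        laplacian_nonpos_of_isLocalMax (hwz.add hn') hm
      rw [hwz.laplacian_add hn', InnerProductSpace.laplacian_smul ε hn, laplacian_norm_sq,
        smul_eq_mul] at this
      linarith [hl z hzΩ]
    have h1 : ‖z‖ ^ 2 ≤ R ^ 2 := pow_le_pow_left₀ (norm_nonneg _) (hR z hz) 2
    nlinarith [h0 z hzf, sq_nonneg ‖x‖]
  by_contra! hpos
  -- This ε bounds w x by half of itself; the +1 keeps the denominator positive when R = 0.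
  have h1 := hbound (w x / (2 * (R ^ 2 + 1))) (by positivity)
  have h2 : w x / (2 * (R ^ 2 + 1)) * R ^ 2 ≤ w x / 2 := by
    rw [div_mul_eq_mul_div, div_le_div_iff₀ (by positivity) two_pos]
    nlinarith
  linarith

/-- The difference of two solutions is harmonic and vanishes on the frontier; the maximum principle
applies to it and to its negative. -/
theorem IsDirichletSolution.eqOn {Ω : Set E3} (hΩ : IsOpen Ω) (hb : Bornology.IsBounded Ω)
    {h g w w' : E3 → ℝ} (hw : IsDirichletSolution Ω h g w) (hw' : IsDirichletSolution Ω h g w') :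
    EqOn w w' (closure Ω) := by
  have key : ∀ {a b : E3 → ℝ}, IsDirichletSolution Ω h g a → IsDirichletSolution Ω h g b →
      ∀ x ∈ closure Ω, (a - b) x ≤ 0 := by
    intro a b ha hb'
    refine nonpos_of_laplacian_nonneg hΩ hb (ha.contDiffOn.sub hb'.contDiffOn)
      (ha.continuousOn.sub hb'.continuousOn) (fun x hx => ?_) fun x hx => ?_
    · rw [(ha.contDiffOn.contDiffAt (hΩ.mem_nhds hx)).laplacian_sub
        (hb'.contDiffOn.contDiffAt (hΩ.mem_nhds hx)), ha.laplacian_eq x hx, hb'.laplacian_eq x hx,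
        sub_self]
    · simp [ha.boundary_eq x hx, hb'.boundary_eq x hx]
  intro x hx
  have h1 := key hw hw' x hx
  have h2 := key hw' hw x hx
  simp only [Pi.sub_apply] at h1 h2
  linarith

/-! ### Integration along rays and projection-slice -/

/-- For a unit vector `ξ`, the map `(s, x) ↦ (x + s ξ, ξ · x)` preserves volume. -/
theorem measurePreserving_ray {ξ : E3} (hξ : ‖ξ‖ = 1) :
    MeasurePreserving (fun p : ℝ × E3 => (p.2 + p.1 • ξ, inner ℝ ξ p.2))
      (volume.prod volume) (volume.prod volume) := by
  -- The map is a shear, a swap and a reflected shear; with y = x + sξ and ‖ξ‖ = 1 one has ξ·y − s =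
  -- ξ·x.
  have h1 : MeasurePreserving (fun p : ℝ × E3 => (p.1, p.2 + p.1 • ξ))
      (volume.prod volume) (volume.prod volume) :=
    (MeasurePreserving.id volume).skew_product (g := fun s x => x + s • ξ) (by fun_prop)
      (Filter.Eventually.of_forall fun s => (measurePreserving_add_right volume (s • ξ)).map_eq)
  have h2 : MeasurePreserving (fun p : E3 × ℝ => (p.1, inner ℝ ξ p.1 - p.2))
      (volume.prod volume) (volume.prod volume) :=
    (MeasurePreserving.id volume).skew_product (g := fun (y : E3) (s : ℝ) => inner ℝ ξ y - s)
      (by fun_prop) (Filter.Eventually.of_forall fun y =>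
        (Measure.measurePreserving_sub_left volume (inner ℝ ξ y)).map_eq)
  convert h2.comp (Measure.measurePreserving_swap.comp h1) using 1
  ext1 p
  simp [inner_add_right, inner_smul_right, hξ]

/-- Pairs (s, x) count each line once for every base point on it. The Gaussian in ξ·x gives this
redundant direction finite mass, and the change of variables turns the integrand into a product. -/
theorem integrable_gaussian_mul_ray {h : E3 → ℂ} (hh : Integrable h) {ξ : E3} (hξ : ‖ξ‖ = 1) :
    Integrable (fun p : ℝ × E3 =>
      h (p.2 + p.1 • ξ) * ((Real.exp (-1 * (inner ℝ ξ p.2) ^ 2) : ℝ) : ℂ))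
      (volume.prod volume) :=
  (measurePreserving_ray hξ).integrable_comp_of_integrable
    (hh.mul_prod (integrable_exp_neg_mul_sq one_pos).ofReal)

theorem ae_integrable_ray {h : E3 → ℂ} (hh : Integrable h) {ξ : E3} (hξ : ‖ξ‖ = 1) :
    ∀ᵐ x : E3, Integrable fun s : ℝ => h (x + s • ξ) := by
  filter_upwards [(integrable_gaussian_mul_ray hh hξ).prod_left_ae] with x hx
  have hne : ((Real.exp (-1 * (inner ℝ ξ x) ^ 2) : ℝ) : ℂ) ≠ 0 := by
    exact_mod_cast (Real.exp_pos _).ne'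
  exact (integrable_mul_const_iff hne.isUnit _).1 hx

/-- The Gaussian-weighted integral over (s, x) is computed twice: as a product with a nonzero
Gaussian factor, and by Fubini with the integral in s innermost. -/
theorem integral_eq_zero_of_ae_integral_ray_eq_zero {h : E3 → ℂ} (hh : Integrable h) {ξ : E3}
    (hξ : ‖ξ‖ = 1) (h0 : ∀ᵐ x : E3, ∫ s : ℝ, h (x + s • ξ) = 0) : ∫ x, h x = 0 := by
  have hg : Integrable (fun p : E3 × ℝ => h p.1 * ((Real.exp (-1 * p.2 ^ 2) : ℝ) : ℂ))
      (volume.prod volume) := hh.mul_prod (integrable_exp_neg_mul_sq one_pos).ofReal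
  have h1 : ∫ p : ℝ × E3, h (p.2 + p.1 • ξ) *
      ((Real.exp (-1 * (inner ℝ ξ p.2) ^ 2) : ℝ) : ℂ) ∂(volume.prod volume) =
      (∫ x, h x) * ∫ s : ℝ, ((Real.exp (-1 * s ^ 2) : ℝ) : ℂ) := by
    rw [← integral_prod_mul, ← (measurePreserving_ray hξ).map_eq, integral_map
      (measurePreserving_ray hξ).measurable.aemeasurable]
    rw [(measurePreserving_ray hξ).map_eq]
    exact hg.aestronglyMeasurable
  have h2 : ∫ p : ℝ × E3, h (p.2 + p.1 • ξ) *
      ((Real.exp (-1 * (inner ℝ ξ p.2) ^ 2) : ℝ) : ℂ) ∂(volume.prod volume) = 0 := by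
    rw [integral_prod_symm _ (integrable_gaussian_mul_ray hh hξ)]
    refine integral_eq_zero_of_ae ?_
    filter_upwards [h0] with x hx
    simp only [integral_mul_const, hx, zero_mul, Pi.zero_apply]
  have h3 : ∫ s : ℝ, ((Real.exp (-1 * s ^ 2) : ℝ) : ℂ) ≠ 0 := by
    rw [integral_complex_ofReal, integral_gaussian]
    have : 0 < √(Real.pi / 1) := Real.sqrt_pos.2 (by positivity)
    exact_mod_cast this.ne'
  rw [h2] at h1
  exact (mul_eq_zero.1 h1.symm).resolve_right h3

/-- Projection-slice: the Fourier transform of a function whose integrals over almost all lines of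
direction `ξ` vanish is zero on the plane orthogonal to `ξ`. -/
theorem fourier_eq_zero_of_ae_integral_ray_eq_zero {h : E3 → ℂ} (hh : Integrable h) {ξ k : E3}
    (hξ : ‖ξ‖ = 1) (hk : inner ℝ ξ k = 0) (h0 : ∀ᵐ x : E3, ∫ s : ℝ, h (x + s • ξ) = 0) :
    FourierTransform.fourier h k = 0 := by
  rw [Real.fourier_eq]
  refine integral_eq_zero_of_ae_integral_ray_eq_zero
    ((Real.fourierIntegral_convergent_iff k).2 hh) hξ ?_
  filter_upwards [h0] with x hx
  -- As ξ ⟂ k, the Fourier character is constant along each ray and leaves the line integral.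
  have : ∀ s : ℝ, inner ℝ (x + s • ξ) k = inner ℝ x k := fun s => by
    simp [inner_add_left, inner_smul_left, hk]
  simp only [this, Circle.smul_def]
  rw [integral_smul, hx, smul_zero]

/-! ### The Kröner symbol on the Fourier side -/

theorem fourier_sum_sum {g : Fin 3 → Fin 3 → E3 → ℂ} (hg : ∀ i j, Integrable (g i j))
    (c : Fin 3 → Fin 3 → ℂ) (k : E3) :
    FourierTransform.fourier (fun x => ∑ i, ∑ j, c i j * g i j x) k =
      ∑ i, ∑ j, c i j * FourierTransform.fourier (g i j) k := by
  simp only [Real.fourier_eq]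
  have hi : ∀ i j, Integrable fun x => Real.fourierChar (-inner ℝ x k) • (c i j * g i j x) :=
    fun i j => (Real.fourierIntegral_convergent_iff k).2 ((hg i j).const_mul _)
  simp only [Finset.smul_sum]
  rw [integral_finsetSum _ fun i _ => integrable_finsetSum _ fun j _ => hi i j]
  refine Finset.sum_congr rfl fun i _ => ?_
  rw [integral_finsetSum _ fun j _ => hi i j]
  refine Finset.sum_congr rfl fun j _ => ?_
  rw [← integral_const_mul]
  congr 1; ext x
  rw [mul_smul_comm]

/-- The Fourier transform of a symmetric tensor field with vanishing longitudinal ray transform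
annihilates pairs of vectors orthogonal to the frequency. -/
theorem fourier_tensor_apply_eq_zero {g : Fin 3 → Fin 3 → E3 → ℂ} (hg : ∀ i j, Integrable (g i j))
    (hs : ∀ i j, g i j = g j i)
    (h0 : ∀ ξ : E3, ‖ξ‖ = 1 →
      ∀ᵐ x : E3, ∫ s : ℝ, ∑ i, ∑ j, (ξ i : ℂ) * ξ j * g i j (x + s • ξ) = 0)
    {a b k : E3} (ha : inner ℝ a k = 0) (hb : inner ℝ b k = 0) :
    ∑ i, ∑ j, (a i : ℂ) * b j * FourierTransform.fourier (g i j) k = 0 := by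
  have unit : ∀ ξ : E3, ‖ξ‖ = 1 → inner ℝ ξ k = 0 →
      ∑ i, ∑ j, (ξ i : ℂ) * ξ j * FourierTransform.fourier (g i j) k = 0 := by
    intro ξ hξ hk
    rw [← fourier_sum_sum hg]
    refine fourier_eq_zero_of_ae_integral_ray_eq_zero ?_ hξ hk (h0 ξ hξ)
    exact integrable_finsetSum _ fun i _ => integrable_finsetSum _ fun j _ => (hg i j).const_mul _
  have quad : ∀ ξ : E3, inner ℝ ξ k = 0 →
      ∑ i, ∑ j, (ξ i : ℂ) * ξ j * FourierTransform.fourier (g i j) k = 0 := by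
    intro ξ hk
    by_cases hξ : ξ = 0
    · simp [hξ]
    have hn : ‖ξ‖ ≠ 0 := norm_ne_zero_iff.2 hξ
    have h1 := unit (‖ξ‖⁻¹ • ξ) (by rw [norm_smul, norm_inv, norm_norm, inv_mul_cancel₀ hn])
      (by rw [inner_smul_left, hk, mul_zero])
    have h2 : ((‖ξ‖ : ℂ)⁻¹ * (‖ξ‖ : ℂ)⁻¹) *
        ∑ i, ∑ j, (ξ i : ℂ) * ξ j * FourierTransform.fourier (g i j) k = 0 := by
      rw [← h1, Finset.mul_sum]
      refine Finset.sum_congr rfl fun i _ => ?_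
      rw [Finset.mul_sum]
      refine Finset.sum_congr rfl fun j _ => ?_
      simp only [PiLp.smul_apply, smul_eq_mul]
      push_cast
      ring
    have h3 : (‖ξ‖ : ℂ)⁻¹ ≠ 0 := inv_ne_zero (by exact_mod_cast hn)
    exact (mul_eq_zero.1 h2).resolve_left (mul_ne_zero h3 h3)
  -- Polarization, using the symmetry of `g`.
  have e1 := quad (a + b) (by rw [inner_add_left, ha, hb, add_zero])
  have e2 := quad a ha
  have e3 := quad b hb
  simp only [Fin.sum_univ_three, PiLp.add_apply, hs 1 0, hs 2 0, hs 2 1] at e1 e2 e3 ⊢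
  push_cast at e1
  linear_combination (e1 - e2 - e3) / 2

/-- The vector is the cross product of the m-th basis vector with k. -/
theorem permSymbol_contract_eq_zero (m : Fin 3) (k : E3) :
    inner ℝ (WithLp.toLp 2 fun i => ∑ q, permSymbol m q i * k q : E3) k = 0 := by
  fin_cases m <;> simp [PiLp.inner_apply, Fin.sum_univ_three, permSymbol] <;> ring

/-- The Kröner symbol of the Fourier transform vanishes. -/
theorem kroner_symbol_fourier_eq_zero {g : Fin 3 → Fin 3 → E3 → ℂ}
    (hg : ∀ i j, Integrable (g i j)) (hs : ∀ i j, g i j = g j i)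
    (h0 : ∀ ξ : E3, ‖ξ‖ = 1 →
      ∀ᵐ x : E3, ∫ s : ℝ, ∑ i, ∑ j, (ξ i : ℂ) * ξ j * g i j (x + s • ξ) = 0)
    (m n : Fin 3) (x : E3) :
    ∑ k, ∑ i, ∑ j, ∑ l, ((permSymbol m k i * permSymbol n j l : ℝ) : ℂ) *
      (FourierTransform.fourier (g i j) x * ((x k : ℂ) * x l)) = 0 := by
  have h := fourier_tensor_apply_eq_zero hg hs h0 (permSymbol_contract_eq_zero m x)
    (permSymbol_contract_eq_zero n x)
  have anti : ∀ j l, permSymbol n j l = - permSymbol n l j := fun j l => by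
    simp only [permSymbol]; ring
  have diag : ∀ j, permSymbol n j j = 0 := fun j => by simp only [permSymbol]; ring
  simp only [Fin.sum_univ_three, anti 1 0, anti 2 0, anti 2 1, diag] at h ⊢
  push_cast at h ⊢
  -- The sign arises because the frequency is contracted with the last index of ε_{njl} here, but
  -- with the middle index in `h`.
  linear_combination (-1) * h

/-! ### Test functions and integration by parts -/

theorem contDiff_partialDeriv {φ : E3 → ℝ} (hφ : ContDiff ℝ (⊤ : ℕ∞) φ) (i : Fin 3) :
    ContDiff ℝ (⊤ : ℕ∞) (partialDeriv i φ) :=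
  (hφ.fderiv_right (m := (⊤ : ℕ∞)) (by simp)).clm_apply contDiff_const

theorem tsupport_partialDeriv_subset (φ : E3 → ℝ) (i : Fin 3) :
    tsupport (partialDeriv i φ) ⊆ tsupport φ := by
  refine closure_minimal (fun x hx => support_fderiv_subset ℝ (f := φ) ?_) (isClosed_tsupport φ)
  intro h
  exact hx (by rw [partialDeriv, h]; simp)

theorem hasCompactSupport_partialDeriv {φ : E3 → ℝ} (hφ : HasCompactSupport φ) (i : Fin 3) :
    HasCompactSupport (partialDeriv i φ) :=
  hφ.of_isClosed_subset (isClosed_tsupport _) (tsupport_partialDeriv_subset φ i)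

theorem integrable_mul_of_tsupport_subset {D : Set E3} {f φ : E3 → ℝ} (hf : ContinuousOn f D)
    (hφ : Continuous φ) (hc : HasCompactSupport φ) (hs : tsupport φ ⊆ D) :
    Integrable fun x => f x * φ x := by
  have h1 : IntegrableOn (fun x => f x * φ x) (tsupport φ) :=
    ContinuousOn.integrableOn_compact hc ((hf.mono hs).mul hφ.continuousOn)
  refine (integrableOn_iff_integrable_of_support_subset ?_).1 h1
  intro x hx
  exact subset_tsupport φ (right_ne_zero_of_mul hx)

/-- Integration by parts against a test function supported in `D`. -/
theorem integral_mul_partialDeriv {D : Set E3} (hD : IsOpen D) {f φ : E3 → ℝ}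
    (hf : ContDiffOn ℝ 1 f D) (hφ : ContDiff ℝ (⊤ : ℕ∞) φ) (hc : HasCompactSupport φ)
    (hs : tsupport φ ⊆ D) (i : Fin 3) :
    ∫ x, f x * partialDeriv i φ x = -∫ x, partialDeriv i f x * φ x := by
  have hf' : ContinuousOn (partialDeriv i f) D :=
    (contDiffOn_partialDeriv (m := 0) hD hf (by norm_num) i).continuousOn
  exact integral_mul_fderiv_eq_neg_fderiv_mul_of_integrable
    (integrable_mul_of_tsupport_subset hf' hφ.continuous hc hs)
    (integrable_mul_of_tsupport_subset hf.continuousOn (contDiff_partialDeriv hφ i).continuous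
      (hasCompactSupport_partialDeriv hc i) ((tsupport_partialDeriv_subset φ i).trans hs))
    (integrable_mul_of_tsupport_subset hf.continuousOn hφ.continuous hc hs)
    (fun x hx => (hf.contDiffAt (hD.mem_nhds (hs hx))).differentiableAt one_ne_zero)
    (fun x _ => hφ.contDiffAt.differentiableAt (by simp))

/-- Moving the derivatives one at a time reverses their order, which yields the order used in
`kronerTensor`. -/
theorem integral_mul_partialDeriv_partialDeriv {D : Set E3} (hD : IsOpen D) {f φ : E3 → ℝ}
    (hf : ContDiffOn ℝ 2 f D) (hφ : ContDiff ℝ (⊤ : ℕ∞) φ) (hc : HasCompactSupport φ)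
    (hs : tsupport φ ⊆ D) (k l : Fin 3) :
    ∫ x, f x * partialDeriv k (partialDeriv l φ) x =
      ∫ x, partialDeriv l (partialDeriv k f) x * φ x := by
  rw [integral_mul_partialDeriv hD (hf.of_le one_le_two) (contDiff_partialDeriv hφ l)
    (hasCompactSupport_partialDeriv hc l) ((tsupport_partialDeriv_subset φ l).trans hs),
    integral_mul_partialDeriv hD (contDiffOn_partialDeriv hD hf le_rfl k) hφ hc hs, neg_neg]

open scoped FourierTransform LineDeriv in
/-- A Schwartz function whose second partial derivatives are Fourier transforms of the products of
coordinates with a fixed Schwartz function. -/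
theorem exists_fourier_eq_partialDeriv_partialDeriv {φ : E3 → ℝ} (hφ : ContDiff ℝ (⊤ : ℕ∞) φ)
    (hc : HasCompactSupport φ) :
    ∃ Ψ : SchwartzMap E3 ℂ, ∀ k l : Fin 3, ∃ θ : SchwartzMap E3 ℂ,
      (∀ x, θ x = ((x k : ℂ) * x l) * Ψ x) ∧
      ∀ x, ((partialDeriv k (partialDeriv l φ) x : ℝ) : ℂ) =
        FourierTransform.fourier (θ : E3 → ℂ) x := by
  have hof : ∀ (f : E3 → ℝ) (i : Fin 3), Differentiable ℝ f → ∀ x,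
      fderiv ℝ (fun y => (f y : ℂ)) x (EuclideanSpace.single i 1) = (partialDeriv i f x : ℂ) := by
    intro f i hf x
    have := (Complex.ofRealCLM.hasFDerivAt.comp x (hf x).hasFDerivAt).fderiv
    simp only [Function.comp_def, Complex.ofRealCLM_apply] at this
    rw [this]
    simp [partialDeriv]
  have hc' : HasCompactSupport (Complex.ofRealCLM ∘ φ) := hc.comp_left (by simp)
  set Φ : SchwartzMap E3 ℂ := hc'.toSchwartzMap (Complex.ofRealCLM.contDiff.comp hφ) with hΦ
  -- Differentiating a Fourier transform in x_k multiplies the original function by −2πi x_k; two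
  -- derivatives give the factor c² in Ψ.
  set c : ℂ := -(2 * Real.pi * Complex.I) with hcdef
  refine ⟨(c * c) • 𝓕⁻ Φ, fun k l => ?_⟩
  set e : Fin 3 → E3 := fun i => EuclideanSpace.single i 1 with he
  have htg : ∀ m : E3, (inner ℝ · m : E3 → ℝ).HasTemperateGrowth := fun m => by fun_prop
  have h1 : LineDeriv.lineDerivOp (e k) (LineDeriv.lineDerivOp (e l) Φ) =
      𝓕 (c • SchwartzMap.smulLeftCLM ℂ (inner ℝ · (e k))
        (c • SchwartzMap.smulLeftCLM ℂ (inner ℝ · (e l)) (𝓕⁻ Φ))) := by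
    conv_lhs => rw [← show 𝓕 (𝓕⁻ Φ) = Φ from FourierTransform.fourier_fourierInv_eq Φ]
    rw [SchwartzMap.lineDerivOp_fourier_eq, SchwartzMap.lineDerivOp_fourier_eq]
  refine ⟨c • SchwartzMap.smulLeftCLM ℂ (inner ℝ · (e k))
    (c • SchwartzMap.smulLeftCLM ℂ (inner ℝ · (e l)) (𝓕⁻ Φ)), fun x => ?_, fun x => ?_⟩
  rotate_left
  · have h2 := congrArg (fun f : SchwartzMap E3 ℂ => f x) h1
    simp only [SchwartzMap.fourier_coe] at h2
    rw [← h2, SchwartzMap.lineDerivOp_apply_eq_fderiv]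
    have h3 : ⇑(LineDeriv.lineDerivOp (e l) Φ) = fun y => (partialDeriv l φ y : ℂ) := by
      ext y
      rw [SchwartzMap.lineDerivOp_apply_eq_fderiv]
      exact hof φ l (hφ.differentiable (by simp)) y
    rw [h3]
    exact (hof _ k ((contDiff_partialDeriv hφ l).differentiable (by simp)) x).symm
  · rw [smul_apply, SchwartzMap.smulLeftCLM_apply_apply (htg (e k)), smul_apply,
      SchwartzMap.smulLeftCLM_apply_apply (htg (e l)), smul_apply]
    simp only [he, EuclideanSpace.inner_single_right, one_mul, smul_eq_mul]
    simp
    ring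

/-! ### Vanishing ray transform implies vanishing Kröner tensor -/

/-- The Kröner tensor, in the sense of distributions, of an integrable symmetric tensor field with
vanishing longitudinal ray transform is zero. -/
theorem sum_integral_kroner_eq_zero {g : Fin 3 → Fin 3 → E3 → ℂ}
    (hg : ∀ i j, Integrable (g i j)) (hs : ∀ i j, g i j = g j i)
    (h0 : ∀ ξ : E3, ‖ξ‖ = 1 →
      ∀ᵐ x : E3, ∫ s : ℝ, ∑ i, ∑ j, (ξ i : ℂ) * ξ j * g i j (x + s • ξ) = 0)
    {φ : E3 → ℝ} (hφ : ContDiff ℝ (⊤ : ℕ∞) φ) (hc : HasCompactSupport φ) (m n : Fin 3) :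
    ∑ k, ∑ i, ∑ j, ∑ l, ((permSymbol m k i * permSymbol n j l : ℝ) : ℂ) *
      ∫ x, g i j x * ((partialDeriv k (partialDeriv l φ) x : ℝ) : ℂ) = 0 := by
  obtain ⟨Ψ, hΨ⟩ := exists_fourier_eq_partialDeriv_partialDeriv hφ hc
  choose θ hθ hθ' using hΨ
  have hcont : ∀ i j, Continuous (FourierTransform.fourier (g i j)) := fun i j =>
    VectorFourier.fourierIntegral_continuous Real.continuous_fourierChar
      (L := innerₗ E3) continuous_inner (hg i j)
  have hbd : ∀ i j x, ‖FourierTransform.fourier (g i j) x‖ ≤ ∫ v, ‖g i j v‖ := fun i j x =>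
    VectorFourier.norm_fourierIntegral_le_integral_norm _ _ (innerₗ E3) _ x
  have hint : ∀ i j k l, Integrable fun x => FourierTransform.fourier (g i j) x * θ k l x :=
    fun i j k l => (θ k l).integrable.bdd_mul (hcont i j).aestronglyMeasurable
      (Filter.Eventually.of_forall (hbd i j))
  -- The transform passes from θ to `g`. As θ = x_k x_l Ψ with one Ψ for all k, l, the summed
  -- integrand is Ψ times the Kröner symbol.
  have hflip : ∀ i j k l, ∫ x, g i j x * ((partialDeriv k (partialDeriv l φ) x : ℝ) : ℂ) =
      ∫ x, FourierTransform.fourier (g i j) x * θ k l x := by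
    intro i j k l
    simp only [hθ']
    have := VectorFourier.integral_fourierIntegral_smul_eq_flip (L := innerₗ E3)
      Real.continuous_fourierChar continuous_inner (hg i j) ((θ k l).integrable (μ := volume))
    rw [flip_innerₗ] at this
    exact this.symm
  simp only [hflip, ← integral_const_mul]
  have hint' : ∀ k i j l, Integrable fun x => ((permSymbol m k i * permSymbol n j l : ℝ) : ℂ) *
      (FourierTransform.fourier (g i j) x * θ k l x) := fun k i j l => (hint i j k l).const_mul _
  have hpull : ∫ x, ∑ k, ∑ i, ∑ j, ∑ l, ((permSymbol m k i * permSymbol n j l : ℝ) : ℂ) *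
      (FourierTransform.fourier (g i j) x * θ k l x) =
      ∑ k, ∑ i, ∑ j, ∑ l, ∫ x, ((permSymbol m k i * permSymbol n j l : ℝ) : ℂ) *
      (FourierTransform.fourier (g i j) x * θ k l x) := by
    rw [integral_finsetSum _ fun k _ => integrable_finsetSum _ fun i _ =>
      integrable_finsetSum _ fun j _ => integrable_finsetSum _ fun l _ => hint' k i j l]
    refine Finset.sum_congr rfl fun k _ => ?_
    rw [integral_finsetSum _ fun i _ =>
      integrable_finsetSum _ fun j _ => integrable_finsetSum _ fun l _ => hint' k i j l]
    refine Finset.sum_congr rfl fun i _ => ?_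
    rw [integral_finsetSum _ fun j _ => integrable_finsetSum _ fun l _ => hint' k i j l]
    refine Finset.sum_congr rfl fun j _ => ?_
    rw [integral_finsetSum _ fun l _ => hint' k i j l]
  rw [← hpull]
  refine integral_eq_zero_of_ae (Filter.Eventually.of_forall fun x => ?_)
  have h := kroner_symbol_fourier_eq_zero hg hs h0 m n x
  have h' := congrArg (· * Ψ x) h
  simp only [zero_mul, Finset.sum_mul] at h'
  rw [Pi.zero_apply, ← h']
  refine Finset.sum_congr rfl fun k _ => Finset.sum_congr rfl fun i _ =>
    Finset.sum_congr rfl fun j _ => Finset.sum_congr rfl fun l _ => ?_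
  rw [hθ]
  ring

theorem continuousOn_kronerTensor_apply {D : Set E3} (hD : IsOpen D) {G : E3 → Tensor2}
    (hG : ∀ i j, ContDiffOn ℝ 2 (fun x => G x i j) D) (m n : Fin 3) :
    ContinuousOn (fun x => kronerTensor G x m n) D := by
  simp only [kronerTensor, Matrix.of_apply]
  refine continuousOn_finsetSum _ fun k _ => continuousOn_finsetSum _ fun i _ =>
    continuousOn_finsetSum _ fun j _ => continuousOn_finsetSum _ fun l _ =>
    continuousOn_const.mul ?_
  exact (contDiffOn_partialDeriv (m := 0) hD
    (contDiffOn_partialDeriv (m := 1) hD (hG i j) le_rfl k) (by norm_num) l).continuousOn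

/-- The Kröner tensor of a symmetric tensor field of class `C²`, integrable on `D`, is zero if the
longitudinal ray transform of the field vanishes on almost all rays of each direction. -/
theorem kronerTensor_eq_zero {D : Set E3} (hD : IsOpen D) {G : E3 → Tensor2}
    (hG : ∀ i j, ContDiffOn ℝ 2 (fun x => G x i j) D)
    (hGi : ∀ i j, IntegrableOn (fun x => G x i j) D) (hGs : ∀ x i j, G x i j = G x j i)
    (h0 : ∀ ξ : E3, ‖ξ‖ = 1 → ∀ᵐ x : E3, tensorLRT D G x ξ = 0) {x : E3} (hx : x ∈ D) :
    kronerTensor G x = 0 := by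
  -- Extension by zero may jump across the boundary of D; this is harmless, since the test functions
  -- used below are supported in D.
  set g : Fin 3 → Fin 3 → E3 → ℂ := fun i j x => ((D.indicator (fun x => G x i j) x : ℝ) : ℂ)
    with hg
  have hgi : ∀ i j, Integrable (g i j) := fun i j =>
    ((integrable_indicator_iff hD.measurableSet).2 (hGi i j)).ofReal
  have hgs : ∀ i j, g i j = g j i := fun i j => by
    ext x; simp only [hg, hGs _ i j]
  have hg0 : ∀ ξ : E3, ‖ξ‖ = 1 →
      ∀ᵐ x : E3, ∫ s : ℝ, ∑ i, ∑ j, (ξ i : ℂ) * ξ j * g i j (x + s • ξ) = 0 := by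
    intro ξ hξ
    filter_upwards [h0 ξ hξ] with x hx
    have e : ∀ s : ℝ, ∑ i, ∑ j, (ξ i : ℂ) * ξ j * g i j (x + s • ξ) =
        (((chord D x ξ).indicator (fun s : ℝ => contract (G (x + s • ξ)) ξ) s : ℝ) : ℂ) := by
      intro s
      by_cases hs : x + s • ξ ∈ D
      · have hs' : s ∈ chord D x ξ := hs
        simp only [hg, indicator_of_mem hs, indicator_of_mem hs', contract]
        push_cast
        exact Finset.sum_congr rfl fun i _ => Finset.sum_congr rfl fun j _ => by ring
      · have hs' : s ∉ chord D x ξ := hs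
        simp [hg, indicator_of_notMem hs, indicator_of_notMem hs']
    simp only [e]
    rw [integral_complex_ofReal, integral_indicator (isOpen_chord hD x ξ).measurableSet]
    exact_mod_cast hx
  ext m n
  have hcK := continuousOn_kronerTensor_apply hD hG m n
  have hae : ∀ᵐ y, y ∈ D → kronerTensor G y m n = 0 := by
    refine hD.ae_eq_zero_of_integral_contDiff_smul_eq_zero
      (hcK.locallyIntegrableOn hD.measurableSet) fun φ hφ hc hs => ?_
    have hw := sum_integral_kroner_eq_zero hgi hgs hg0 hφ hc m n
    have hterm : ∀ i j k l, ∫ x, g i j x * ((partialDeriv k (partialDeriv l φ) x : ℝ) : ℂ) =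
        ((∫ x, partialDeriv l (partialDeriv k fun y => G y i j) x * φ x : ℝ) : ℂ) := by
      intro i j k l
      rw [← integral_mul_partialDeriv_partialDeriv hD (hG i j) hφ hc hs, ← integral_complex_ofReal]
      congr 1; ext y
      by_cases hy : y ∈ D
      · simp [hg, hy]
      · have : partialDeriv k (partialDeriv l φ) y = 0 := by
          by_contra hne
          exact hy (hs (tsupport_partialDeriv_subset _ _ (tsupport_partialDeriv_subset _ _
            (subset_tsupport _ hne))))
        simp [this]
    simp only [hterm] at hw
    have hint : ∀ k i j l, Integrable fun y => permSymbol m k i * permSymbol n j l *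
        (partialDeriv l (partialDeriv k fun y => G y i j) y * φ y) := by
      intro k i j l
      refine (integrable_mul_of_tsupport_subset ?_ hφ.continuous hc hs).const_mul _
      exact (contDiffOn_partialDeriv (m := 0) hD
        (contDiffOn_partialDeriv (m := 1) hD (hG i j) le_rfl k) (by norm_num) l).continuousOn
    have hexp : (fun y => φ y • kronerTensor G y m n) = fun y => ∑ k, ∑ i, ∑ j, ∑ l,
        permSymbol m k i * permSymbol n j l *
        (partialDeriv l (partialDeriv k fun y => G y i j) y * φ y) := by
      ext y
      simp only [kronerTensor, Matrix.of_apply, smul_eq_mul, Finset.mul_sum]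
      exact Finset.sum_congr rfl fun k _ => Finset.sum_congr rfl fun i _ =>
        Finset.sum_congr rfl fun j _ => Finset.sum_congr rfl fun l _ => by ring
    rw [hexp, integral_finsetSum _ fun k _ => integrable_finsetSum _ fun i _ =>
      integrable_finsetSum _ fun j _ => integrable_finsetSum _ fun l _ => hint k i j l]
    have hw' : ∑ k, ∑ i, ∑ j, ∑ l, permSymbol m k i * permSymbol n j l *
        ∫ x, partialDeriv l (partialDeriv k fun y => G y i j) x * φ x = 0 := by
      exact_mod_cast hw
    rw [← hw']
    refine Finset.sum_congr rfl fun k _ => ?_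
    rw [integral_finsetSum _ fun i _ =>
      integrable_finsetSum _ fun j _ => integrable_finsetSum _ fun l _ => hint k i j l]
    refine Finset.sum_congr rfl fun i _ => ?_
    rw [integral_finsetSum _ fun j _ => integrable_finsetSum _ fun l _ => hint k i j l]
    refine Finset.sum_congr rfl fun j _ => ?_
    rw [integral_finsetSum _ fun l _ => hint k i j l]
    exact Finset.sum_congr rfl fun l _ => integral_const_mul _ _
  have hres : (fun y => kronerTensor G y m n) =ᵐ[volume.restrict D] fun _ => 0 :=
    (ae_restrict_iff' hD.measurableSet).2 hae
  exact Measure.eqOn_open_of_ae_eq hres hD hcK continuousOn_const hx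

/-! ### The data determine the Kröner tensor -/

theorem IsDopplerPotential.contDiffOn_gradSq_apply {D : Set E3} (hD : IsOpen D) {u : E3 → ℝ}
    (hu : IsDopplerPotential D u) (i j : Fin 3) : ContDiffOn ℝ 2 (fun x => gradSq u x i j) D := by
  simp only [gradSq_apply]
  exact (contDiffOn_partialDeriv hD hu.contDiffOn (by norm_num) i).mul
    (contDiffOn_partialDeriv hD hu.contDiffOn (by norm_num) j)

theorem IsDopplerPotential.integrableOn_gradSq_apply {D : Set E3} {u : E3 → ℝ}
    (hu : IsDopplerPotential D u) (i j : Fin 3) : IntegrableOn (fun x => gradSq u x i j) D := by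
  have h : ∀ i, MemLp (partialDeriv i u) 2 (volume.restrict D) := fun i => by
    rw [show partialDeriv i u = fun x => gradient u x i from
      funext fun x => (gradient_apply_eq_partialDeriv u x i).symm]
    exact (EuclideanSpace.proj i : E3 →L[ℝ] ℝ).comp_memLp' hu.memLp
  simp only [gradSq_apply]
  exact (h i).integrable_mul (h j)

/-- Allows the line integral of a difference to be split. Rays on which an integral takes the
default value 0 form a null set for each direction and are discarded. -/
theorem IsDopplerPotential.ae_integrableOn_chord {D : Set E3} (hD : IsOpen D) {u : E3 → ℝ}
    (hu : IsDopplerPotential D u) {ξ : E3} (hξ : ‖ξ‖ = 1) :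
    ∀ᵐ x : E3, IntegrableOn (fun s : ℝ => contract (gradSq u (x + s • ξ)) ξ) (chord D x ξ) := by
  have h1 : IntegrableOn (fun x => contract (gradSq u x) ξ) D := by
    simp only [contract]
    exact integrable_finsetSum _ fun i _ => integrable_finsetSum _ fun j _ =>
      ((hu.integrableOn_gradSq_apply i j).const_mul (ξ i)).mul_const (ξ j)
  have h2 : Integrable fun x => ((D.indicator (fun x => contract (gradSq u x) ξ) x : ℝ) : ℂ) :=
    ((integrable_indicator_iff hD.measurableSet).2 h1).ofReal
  filter_upwards [ae_integrable_ray h2 hξ] with x hx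
  rw [← integrable_indicator_iff (isOpen_chord hD x ξ).measurableSet]
  exact hx.re

theorem contract_sub (A B : Tensor2) (ξ : E3) :
    contract (A - B) ξ = contract A ξ - contract B ξ := by
  simp only [contract, Matrix.sub_apply, mul_sub, sub_mul, Finset.sum_sub_distrib]

theorem kronerTensor_sub {D : Set E3} (hD : IsOpen D) {F G : E3 → Tensor2}
    (hF : ∀ i j, ContDiffOn ℝ 2 (fun x => F x i j) D)
    (hG : ∀ i j, ContDiffOn ℝ 2 (fun x => G x i j) D) {x : E3} (hx : x ∈ D) :
    kronerTensor (fun y => F y - G y) x = kronerTensor F x - kronerTensor G x := by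
  have d1 : ∀ {f : E3 → ℝ}, ContDiffOn ℝ 2 f D → ∀ y ∈ D, DifferentiableAt ℝ f y := fun hf y hy =>
    (hf.contDiffAt (hD.mem_nhds hy)).differentiableAt two_ne_zero
  have d2 : ∀ {f : E3 → ℝ}, ContDiffOn ℝ 2 f D → ∀ k, DifferentiableAt ℝ (partialDeriv k f) x :=
    fun hf k => ((contDiffOn_partialDeriv (m := 1) hD hf le_rfl k).contDiffAt
      (hD.mem_nhds hx)).differentiableAt one_ne_zero
  have key : ∀ i j k l, partialDeriv l (partialDeriv k fun y => (F y - G y) i j) x =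
      partialDeriv l (partialDeriv k fun y => F y i j) x -
      partialDeriv l (partialDeriv k fun y => G y i j) x := by
    intro i j k l
    rw [← partialDeriv_sub (d2 (hF i j) k) (d2 (hG i j) k)]
    exact partialDeriv_congr hD
      (fun y hy => partialDeriv_sub (d1 (hF i j) y hy) (d1 (hG i j) y hy) k) l hx
  ext m n
  simp only [kronerTensor, Matrix.of_apply, Matrix.sub_apply, ← Finset.sum_sub_distrib, ← mul_sub]
  simp only [← Matrix.sub_apply, key]

/-- The second moment data determine the Kröner tensor. -/
theorem kronerTensor_eq_of_secondMomentHLRT_eq {D : Set E3} (hD : IsOpen D) {u v : E3 → ℝ}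
    (hu : IsDopplerPotential D u) (hv : IsDopplerPotential D v)
    (h : ∀ x ξ : E3, ‖ξ‖ = 1 →
      secondMomentHLRT D (gradient v) x ξ = secondMomentHLRT D (gradient u) x ξ)
    {x : E3} (hx : x ∈ D) : kronerTensor (gradSq v) x = kronerTensor (gradSq u) x := by
  have cu := hu.contDiffOn_gradSq_apply hD
  have cv := hv.contDiffOn_gradSq_apply hD
  rw [← sub_eq_zero, ← kronerTensor_sub hD cv cu hx]
  refine kronerTensor_eq_zero (G := fun y => gradSq v y - gradSq u y) hD (fun i j => (cv i j).sub (cu i j))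
    (fun i j => (hv.integrableOn_gradSq_apply i j).sub (hu.integrableOn_gradSq_apply i j))
    (fun y i j => ?_) (fun ξ hξ => ?_) hx
  · simp only [Matrix.sub_apply, gradSq_apply]
    ring
  · filter_upwards [hu.ae_integrableOn_chord hD hξ, hv.ae_integrableOn_chord hD hξ] with y hyu hyv
    have h1 := h y ξ hξ
    rw [secondMomentHLRT_gradient hD (hu.contDiffOn.of_le (by norm_num)),
      secondMomentHLRT_gradient hD (hv.contDiffOn.of_le (by norm_num))] at h1
    simp only [tensorLRT, contract_sub] at h1 ⊢
    rw [integral_sub hyv hyu, h1, sub_self]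

/-! ### The global sign and the Poisson problem -/

/-- The Hessian is recovered from the Kröner tensor with a single sign on a connected set. -/
theorem exists_sign_hessianMatrix_eq {D : Set E3} (hD : IsOpen D) {u : E3 → ℝ}
    (hu : ContDiffOn ℝ 3 u D) {Ω : Set E3} (hΩD : Ω ⊆ D) (hΩc : IsPreconnected Ω)
    (hdet : ∀ x ∈ Ω, (kronerTensor (gradSq u) x).det ≠ 0) :
    ∃ σ : ℝ, (σ = 1 ∨ σ = -1) ∧ ∀ x ∈ Ω, hessianMatrix u x =
      (σ * Real.sqrt ((1 / 2) * (kronerTensor (gradSq u) x).det)) •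
        (kronerTensor (gradSq u) x)⁻¹ := by
  have hH : ∀ x ∈ Ω, (hessianMatrix u x).det ≠ 0 := fun x hx h => hdet x hx (by
    rw [kronerTensor_gradSq hD hu (hΩD hx), det_two_smul_adjugate, h]; simp)
  have hcont : ContinuousOn (fun x => (hessianMatrix u x).det) Ω := by
    have hc : ∀ i j, ContinuousOn (fun x => hessianMatrix u x i j) Ω := fun i j => by
      simp only [hessianMatrix, Matrix.of_apply]
      exact (contDiffOn_partialDeriv (m := 1) hD
        (contDiffOn_partialDeriv (m := 2) hD hu (by norm_num) i) (by norm_num) j).continuousOn.mono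
          hΩD
    exact continuous_id.matrix_det.comp_continuousOn
      (continuousOn_pi.2 fun i => continuousOn_pi.2 fun j => hc i j)
  have key : ∀ σ : ℝ, (∀ x ∈ Ω, σ * (|(hessianMatrix u x).det| / (hessianMatrix u x).det) = 1) →
      ∀ x ∈ Ω, hessianMatrix u x =
      (σ * Real.sqrt ((1 / 2) * (kronerTensor (gradSq u) x).det)) •
        (kronerTensor (gradSq u) x)⁻¹ := by
    intro σ hσ x hx
    rw [kronerTensor_gradSq hD hu (hΩD hx), mul_smul, sqrt_smul_inv_two_smul_adjugate (hH x hx),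
      smul_smul, hσ x hx, one_smul]
  -- The sign is that of det H. If det H is not positive throughout Ω, the intermediate value
  -- theorem makes it negative throughout, since it has no zero.
  by_cases hpos : ∀ x ∈ Ω, 0 < (hessianMatrix u x).det
  · refine ⟨1, Or.inl rfl, key 1 fun x hx => ?_⟩
    rw [abs_of_pos (hpos x hx), div_self (hH x hx), one_mul]
  · push Not at hpos
    obtain ⟨y, hy, hy0⟩ := hpos
    refine ⟨-1, Or.inr rfl, key (-1) fun x hx => ?_⟩
    have hneg : (hessianMatrix u x).det < 0 := by
      by_contra! hx0
      obtain ⟨z, hz, hz0⟩ := hΩc.intermediate_value hy hx hcont ⟨hy0, hx0⟩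
      exact hH z hz hz0
    rw [abs_of_neg hneg, neg_div, div_self (hH x hx)]
    norm_num

theorem IsDirichletSolution.const_mul {Ω : Set E3} (hΩ : IsOpen Ω) {h g w : E3 → ℝ}
    (hw : IsDirichletSolution Ω h g w) (c : ℝ) :
    IsDirichletSolution Ω (fun x => c * h x) (fun x => c * g x) (fun x => c * w x) where
  contDiffOn := contDiffOn_const.mul hw.contDiffOn
  continuousOn := continuousOn_const.mul hw.continuousOn
  laplacian_eq x hx := by
    have := InnerProductSpace.laplacian_smul c (hw.contDiffOn.contDiffAt (hΩ.mem_nhds hx))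
    rw [hw.laplacian_eq x hx] at this
    exact this
  boundary_eq x hx := by rw [hw.boundary_eq x hx]

theorem IsDirichletSolution.congr {Ω : Set E3} (hΩ : IsOpen Ω) {h g w w' : E3 → ℝ}
    (hw : IsDirichletSolution Ω h g w) (he : EqOn w' w (closure Ω)) :
    IsDirichletSolution Ω h g w' where
  contDiffOn := hw.contDiffOn.congr fun _ hx => he (subset_closure hx)
  continuousOn := hw.continuousOn.congr he
  laplacian_eq x hx := by
    rw [← hw.laplacian_eq x hx]
    exact InnerProductSpace.laplacian_congr_nhds
      ((he.mono subset_closure).eventuallyEq_of_mem (hΩ.mem_nhds hx)) |>.eq_of_nhds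
  boundary_eq x hx := by rw [he (frontier_subset_closure hx), hw.boundary_eq x hx]

theorem IsDirichletSolution.congr_boundary {Ω : Set E3} {h g g' w : E3 → ℝ}
    (hw : IsDirichletSolution Ω h g w) (he : ∀ x ∈ frontier Ω, g x = g' x) :
    IsDirichletSolution Ω h g' w :=
  ⟨hw.contDiffOn, hw.continuousOn, hw.laplacian_eq, fun x hx =>
    (hw.boundary_eq x hx).trans (he x hx)⟩

/-- A potential solves the Poisson problem obtained from its Kröner tensor. -/
theorem isDirichletSolution_poissonSource {D : Set E3} (hD : IsOpen D) {u : E3 → ℝ}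
    (hu : ContDiffOn ℝ 3 u D) {Ω : Set E3} (hΩD : Ω ⊆ D)
    (hc : ContinuousOn u (closure Ω)) {K : E3 → Tensor2} {σ : ℝ}
    (hσ : ∀ x ∈ Ω, hessianMatrix u x = (σ * Real.sqrt ((1 / 2) * (K x).det)) • (K x)⁻¹) :
    IsDirichletSolution Ω (fun x => σ * poissonSource K x) u u where
  contDiffOn := (hu.mono hΩD).of_le (by norm_num)
  continuousOn := hc
  laplacian_eq x hx := by
    rw [laplacian_eq_trace_hessianMatrix
      ((hu.contDiffAt (hD.mem_nhds (hΩD hx))).of_le (by norm_num)), hσ x hx, Matrix.trace_smul,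
      poissonSource, smul_eq_mul, mul_assoc]
  boundary_eq _ _ := rfl

/-! ### The main theorem -/

theorem mainTheorem2 (D : Set E3) (hD : IsOpen D) (u : E3 → ℝ) (hu : IsDopplerPotential D u) :
    -- the second moment of the histogram transform of `du` is the ray transform of `du ⊙ du`
    (∀ x ξ : E3, ‖ξ‖ = 1 →
      secondMomentHLRT D (gradient u) x ξ = tensorLRT D (gradSq u) x ξ ∧
      (Integrable (fun y : ℝ => y ^ 2) (histogramLRT D (gradient u) x ξ) ↔
        IntegrableOn (fun s : ℝ => contract (gradSq u (x + s • ξ)) ξ) (chord D x ξ))) ∧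
    -- the second moment data determine the Kröner tensor of `du ⊙ du`
    (∀ v : E3 → ℝ, IsDopplerPotential D v →
      (∀ x ξ : E3, ‖ξ‖ = 1 →
        secondMomentHLRT D (gradient v) x ξ = secondMomentHLRT D (gradient u) x ξ) →
      ∀ x ∈ D, kronerTensor (gradSq v) x = kronerTensor (gradSq u) x) ∧
    -- `K = 2 Adj(d²u)`
    (∀ x ∈ D, kronerTensor (gradSq u) x = (2 : ℝ) • (hessianMatrix u x).adjugate) ∧
    -- `d²u = ± √(½ det K) K⁻¹` wherever `det K ≠ 0`
    (∀ x ∈ D, (kronerTensor (gradSq u) x).det ≠ 0 →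
      0 < (kronerTensor (gradSq u) x).det ∧
      (hessianMatrix u x = Real.sqrt ((1 / 2) * (kronerTensor (gradSq u) x).det) •
          (kronerTensor (gradSq u) x)⁻¹ ∨
        hessianMatrix u x = -(Real.sqrt ((1 / 2) * (kronerTensor (gradSq u) x).det) •
          (kronerTensor (gradSq u) x)⁻¹))) ∧
    -- recovery of `u` from `K` and its boundary data, up to a global sign
    (∀ Ω : Set E3, Ω ⊆ D → IsOpen Ω → IsPreconnected Ω → Bornology.IsBounded Ω →
      (∀ x ∈ Ω, (kronerTensor (gradSq u) x).det ≠ 0) → ContinuousOn u (closure Ω) →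
      -- each of the two Poisson problems has at most one solution for given boundary data
      (∀ τ : ℝ, (τ = 1 ∨ τ = -1) → ∀ g w w' : E3 → ℝ,
        IsDirichletSolution Ω (fun x => τ * poissonSource (kronerTensor (gradSq u)) x) g w →
        IsDirichletSolution Ω (fun x => τ * poissonSource (kronerTensor (gradSq u)) x) g w' →
        EqOn w w' (closure Ω)) ∧
      ∃ σ : ℝ, (σ = 1 ∨ σ = -1) ∧
        -- one sign serves throughout `Ω`, and `u` solves the Poisson problem with that sign
        (∀ x ∈ Ω, hessianMatrix u x =
          (σ * Real.sqrt ((1 / 2) * (kronerTensor (gradSq u) x).det)) •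
            (kronerTensor (gradSq u) x)⁻¹) ∧
        IsDirichletSolution Ω (fun x => σ * poissonSource (kronerTensor (gradSq u)) x) u u ∧
        -- changing the sign of the equation and of the boundary data changes the sign of `u`
        (∀ τ : ℝ, (τ = 1 ∨ τ = -1) → ∀ w : E3 → ℝ,
          (IsDirichletSolution Ω
              (fun x => (τ * σ) * poissonSource (kronerTensor (gradSq u)) x)
              (fun x => τ * u x) w ↔
            EqOn w (fun x => τ * u x) (closure Ω))) ∧
        -- with zero boundary data the solutions are exactly `u` and `-u`
        ((∀ x ∈ frontier Ω, u x = 0) → ∀ w : E3 → ℝ,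
          ((∃ τ : ℝ, (τ = 1 ∨ τ = -1) ∧ IsDirichletSolution Ω
              (fun x => τ * poissonSource (kronerTensor (gradSq u)) x) (fun _ => 0) w) ↔
            (EqOn w u (closure Ω) ∨ EqOn w (fun x => -u x) (closure Ω)))) ∧
        -- hence the second moment data and the boundary data determine `u` up to a global sign
        (∀ v : E3 → ℝ, IsDopplerPotential D v → ContinuousOn v (closure Ω) →
          (∀ x ξ : E3, ‖ξ‖ = 1 →
            secondMomentHLRT D (gradient v) x ξ = secondMomentHLRT D (gradient u) x ξ) →
          (∃ τ : ℝ, (τ = 1 ∨ τ = -1) ∧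
            (∀ x ∈ Ω, hessianMatrix v x = τ • hessianMatrix u x) ∧
            ((∀ x ∈ frontier Ω, v x = τ * u x) →
              EqOn v (fun x => τ * u x) (closure Ω))) ∧
          ((∀ x ∈ frontier Ω, v x = u x) →
            (EqOn v u (closure Ω) ∨
              IsDirichletSolution Ω
                (fun x => -σ * poissonSource (kronerTensor (gradSq u)) x) u v)) ∧
          ((∀ x ∈ frontier Ω, u x = 0) → (∀ x ∈ frontier Ω, v x = 0) →
            (EqOn v u (closure Ω) ∨ EqOn v (fun x => -u x) (closure Ω))))) := by
  have hu1 : ContDiffOn ℝ 1 u D := hu.contDiffOn.of_le (by norm_num)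
  refine ⟨fun x ξ _ => ⟨secondMomentHLRT_gradient hD hu1 x ξ,
      integrable_sq_histogramLRT_iff hD hu1 x ξ⟩,
    fun v hv h x hx => kronerTensor_eq_of_secondMomentHLRT_eq hD hu hv h hx,
    fun x hx => kronerTensor_gradSq hD hu.contDiffOn hx, fun x hx hdet => ?_, ?_⟩
  · rw [kronerTensor_gradSq hD hu.contDiffOn hx, det_two_smul_adjugate] at hdet
    have hH : (hessianMatrix u x).det ≠ 0 := fun h => hdet (by rw [h]; simp)
    rw [kronerTensor_gradSq hD hu.contDiffOn hx, sqrt_smul_inv_two_smul_adjugate hH,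
      det_two_smul_adjugate]
    refine ⟨by positivity, ?_⟩
    rcases lt_or_gt_of_ne hH with h | h
    · right
      rw [abs_of_neg h, neg_div, div_self hH, neg_smul, one_smul, neg_neg]
    · left
      rw [abs_of_pos h, div_self hH, one_smul]
  intro Ω hΩD hΩ hΩc hΩb hdet hcu
  refine ⟨fun τ _ g w w' hw hw' => hw.eqOn hΩ hΩb hw', ?_⟩
  obtain ⟨σ, hσ, hHu⟩ := exists_sign_hessianMatrix_eq hD hu.contDiffOn hΩD hΩc hdet
  have hsol := isDirichletSolution_poissonSource hD hu.contDiffOn hΩD hcu hHu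
  have hsolτ : ∀ τ : ℝ, IsDirichletSolution Ω
      (fun x => (τ * σ) * poissonSource (kronerTensor (gradSq u)) x)
      (fun x => τ * u x) (fun x => τ * u x) := by
    intro τ
    simpa only [mul_assoc] using hsol.const_mul hΩ τ
  refine ⟨σ, hσ, hHu, hsol, fun τ _ w => ⟨fun hw => hw.eqOn hΩ hΩb (hsolτ τ),
    fun hw => (hsolτ τ).congr hΩ hw⟩, fun hu0 w => ⟨?_, ?_⟩, fun v hv hcv hdata => ?_⟩
  · rintro ⟨τ, hτ, hw⟩
    -- Since σ² = 1, the problem with sign τ is the one solved by (τσ)u.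
    have hστ : τ * σ * σ = τ := by rcases hσ with rfl | rfl <;> ring
    have h1 := hsolτ (τ * σ)
    rw [hστ] at h1
    have h2 := hw.eqOn hΩ hΩb
      (h1.congr_boundary (g' := fun _ => 0) fun x hx => by rw [hu0 x hx, mul_zero])
    have h3 : τ * σ = 1 ∨ τ * σ = -1 := by
      rcases hσ with rfl | rfl <;> rcases hτ with rfl | rfl <;> norm_num
    rcases h3 with h3 | h3
    · left; simpa [h3] using h2
    · right; simpa [h3] using h2
  · have hb : ∀ τ : ℝ, ∀ x ∈ frontier Ω, τ * u x = (fun _ => 0) x := fun τ x hx => by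
      rw [hu0 x hx, mul_zero]
    rintro (h | h)
    · refine ⟨σ, hσ, ((hsol.congr hΩ h).congr_boundary hu0)⟩
    · refine ⟨-1 * σ, ?_, ((hsolτ (-1)).congr_boundary (hb _)).congr hΩ (by simpa using h)⟩
      rcases hσ with rfl | rfl <;> norm_num
  · have hK : ∀ x ∈ D, kronerTensor (gradSq v) x = kronerTensor (gradSq u) x := fun x hx =>
      kronerTensor_eq_of_secondMomentHLRT_eq hD hu hv hdata hx
    obtain ⟨ρ, hρ, hHv⟩ := exists_sign_hessianMatrix_eq hD hv.contDiffOn hΩD hΩc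
      fun x hx => by rw [hK x (hΩD hx)]; exact hdet x hx
    have hHv' : ∀ x ∈ Ω, hessianMatrix v x =
        (ρ * Real.sqrt ((1 / 2) * (kronerTensor (gradSq u) x).det)) •
          (kronerTensor (gradSq u) x)⁻¹ := fun x hx => by
      rw [hHv x hx, hK x (hΩD hx)]
    have hsolv := isDirichletSolution_poissonSource hD hv.contDiffOn hΩD hcv hHv'
    -- The Hessians of v and u carry signs ρ and σ relative to the same K, so the relative sign is
    -- ρσ.
    have hρσ : ρ * σ * σ = ρ := by rcases hσ with rfl | rfl <;> ring
    have hτ : ρ * σ = 1 ∨ ρ * σ = -1 := by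
      rcases hσ with rfl | rfl <;> rcases hρ with rfl | rfl <;> norm_num
    have hrec : (∀ x ∈ frontier Ω, v x = ρ * σ * u x) →
        EqOn v (fun x => ρ * σ * u x) (closure Ω) := fun hbd => by
      have h1 := hsolτ (ρ * σ)
      rw [hρσ] at h1
      exact (hsolv.congr_boundary hbd).eqOn hΩ hΩb h1
    refine ⟨⟨ρ * σ, hτ, fun x hx => ?_, hrec⟩, fun hbd => ?_, fun hu0 hv0 => ?_⟩
    · rw [hHv' x hx, hHu x hx, smul_smul, ← mul_assoc, hρσ]
    · rcases hτ with h | h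
      · left
        simpa [h] using hrec fun x hx => by rw [h, one_mul, hbd x hx]
      · right
        have : ρ = -σ := by rw [← hρσ, h]; ring
        rw [this] at hsolv
        exact hsolv.congr_boundary hbd
    · have h1 := hrec fun x hx => by rw [hu0 x hx, hv0 x hx, mul_zero]
      rcases hτ with h | h
      · left; simpa [h] using h1
      · right; simpa [h] using h1
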